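/- **Model.** Let $q\in(1/2,1)$ be a constant. For a finite graph $G=(V,E)$ on $n$ vertices (agents), let the ground truth $\theta\in\{0,1\}$ be a fair coin and, given $\theta$, let the private signals $s_v$ ($v\in V$) be independent with $\mathbb P(s_v=\theta)=q$. A decision order $\sigma$ is a permutation of $V$. In this order each agent $v$ takes an action $a_v\in\{0,1\}$. In the Bayesian model $v$ knows $G$, $\sigma$, its own signal $s_v$ and the actions of those neighbours of $v$ in $G$ that precede it in $\sigma$, and $a_v$ is the value of $\theta$ with the larger posterior probability given this information; if the two posterior probabilities are equal, $a_v$ is given by an arbitrary fixed deterministic tie-breaking rule (a function of $G$, $\sigma$, $v$ and the information of $v$). Put $$L_\sigma(G)=\frac1n\sum_{v\in V}\mathbb P(a_v=\theta).$$ For the Erdős–Rényi random graph $G(n,p)$ ($n$ vertices, each pair joined independently with probability $p$) the learning quality under optimal decision orders is $$L(G(n,p))=\sum_{G}\mathbb P\big(G(n,p)=G\big)\,\max_\sigma L_\sigma(G),$$ the sum being over all graphs on $n$ labelled vertices. The family $\{G(n,p(n))\}_n$ achieves asymptotic truth learning under the Bayesian model if $L(G(n,p(n)))\to1$ as $n\to\infty$.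 **Proposition.** Let $p(n)\in[0,1]$ satisfy $p(n)=\omega(1)/n$ and, for every $\varepsilon$ with $0<\varepsilon<1$, $1-p(n)=\omega(n^{\varepsilon})/n$. Then, for every $q\in(1/2,1)$ and every tie-breaking rule, the family of Erdős–Rényi graphs $G(n,p(n))$ achieves asymptotic truth learning under the Bayesian model. -/

import Mathlib

open Filter Topology Asymptotics

namespace SocialLearning

noncomputable section

/-- A state of the world for `n` agents: the ground truth `θ` and the private signals `s`. -/
abbrev World (n : ℕ) : Type := Bool × (Fin n → Bool)

/-- The probability of a world: `θ` is a fair coin and, given `θ`, the private signals are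
independent, each equal to `θ` with probability `q`. -/
def worldProb {n : ℕ} (q : ℝ) (ω : World n) : ℝ :=
  1 / 2 * ∏ v : Fin n, if ω.2 v = ω.1 then q else 1 - q

open Classical in
/-- The probability of an event. -/
def prob {n : ℕ} (q : ℝ) (E : Set (World n)) : ℝ :=
  ∑ ω : World n, if ω ∈ E then worldProb q ω else 0

/-- `u` is a neighbour of `v` that decides before `v`. Here `σ i` is the agent in position `i` of
the decision order, so `σ.symm v` is the position of `v`. -/
def EarlierNbr {n : ℕ} (G : SimpleGraph (Fin n)) (σ : Equiv.Perm (Fin n)) (u v : Fin n) : Prop :=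
  G.Adj v u ∧ σ.symm u < σ.symm v

/-- What an agent observes: its own private signal and, for each agent, the action of that agent
(`none` when this action is not visible). -/
abbrev Observation (n : ℕ) : Type := Bool × (Fin n → Option Bool)

/-- A rule by which agents choose when both values of `θ` are equally likely given what they know:
the network, the decision order, and their observation. -/
abbrev TieRule (n : ℕ) : Type :=
  SimpleGraph (Fin n) → Equiv.Perm (Fin n) → Fin n → Observation n → Bool

open Classical in
/-- The Bayesian decision of an agent whose observation, as a function of the private signals of
all agents, is `obs`, and for whom this observation takes the value `x`: the value of `θ` with the
larger posterior probability given `obs = x`, and the value `tie` if the two are equal.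
The posterior probabilities are compared through the joint probabilities
`ℙ(θ = b, obs = x)`, which differ from them by the common factor `ℙ(obs = x)`. -/
def bayesDecision {n : ℕ} (q : ℝ) (obs : (Fin n → Bool) → Observation n) (x : Observation n)
    (tie : Bool) : Bool :=
  if prob q {ω | ω.1 = false ∧ obs ω.2 = x} < prob q {ω | ω.1 = true ∧ obs ω.2 = x} then true
  else if prob q {ω | ω.1 = true ∧ obs ω.2 = x} < prob q {ω | ω.1 = false ∧ obs ω.2 = x} then false
  else tie

open Classical in
/-- The action of agent `v` in the learning network `(G, q, σ)` under the Bayesian model, as a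
function of the private signals of all agents. It is defined by recursion along the decision
order: `v` observes its own signal and the actions of its earlier neighbours. -/
def action {n : ℕ} (q : ℝ) (τ : TieRule n) (G : SimpleGraph (Fin n)) (σ : Equiv.Perm (Fin n))
    (v : Fin n) : (Fin n → Bool) → Bool :=
  let obs : (Fin n → Bool) → Observation n := fun s =>
    (s v, fun u => if _h : EarlierNbr G σ u v then some (action q τ G σ u s) else none)
  fun s => bayesDecision q obs (obs s) (τ G σ v (obs s))
termination_by σ.symm v
decreasing_by exact _h.2

/-- The learning quality `ℓ(v) = ℙ(a_v = θ)` of an agent. -/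
def agentQuality {n : ℕ} (q : ℝ) (τ : TieRule n) (G : SimpleGraph (Fin n))
    (σ : Equiv.Perm (Fin n)) (v : Fin n) : ℝ :=
  prob q {ω | action q τ G σ v ω.2 = ω.1}

/-- The learning quality `L_σ(G)` of the network: the average learning quality of its agents. -/
def networkQuality {n : ℕ} (q : ℝ) (τ : TieRule n) (G : SimpleGraph (Fin n))
    (σ : Equiv.Perm (Fin n)) : ℝ :=
  1 / (n : ℝ) * ∑ v : Fin n, agentQuality q τ G σ v

/-- The learning quality of the network under an optimal decision order. -/
def optimalQuality {n : ℕ} (q : ℝ) (τ : TieRule n) (G : SimpleGraph (Fin n)) : ℝ :=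
  ⨆ σ : Equiv.Perm (Fin n), networkQuality q τ G σ

open Classical in
/-- The learning quality of the Erdős–Rényi graph `G(n, p)`, with the optimal decision order
chosen for each graph: `∑_G ℙ(G(n, p) = G) · max_σ L_σ(G)`. -/
def erdosRenyiQuality (q : ℝ) (n : ℕ) (τ : TieRule n) (p : unitInterval) : ℝ :=
  ∑ G : SimpleGraph (Fin n),
    (SimpleGraph.binomialRandom (Fin n) p).real {G} * optimalQuality q τ G

/-- The family `G(n, p n)` achieves network-wide asymptotic truth learning under the Bayesian
model with signal accuracy `q` (and ties resolved by `τ`). -/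
def ErdosRenyiTruthLearning (q : ℝ) (τ : ∀ n : ℕ, TieRule n) (p : ℕ → unitInterval) : Prop :=
  Tendsto (fun n : ℕ => erdosRenyiQuality q n (τ n) (p n)) atTop (𝓝 1)

end

end SocialLearning

/-! A Bayesian agent is at least as accurate as any fixed function of what it sees. Two consequences
suffice: an agent seeing `k` agents who follow their own signals beats their majority vote
(`agentQuality_of_signal_followers`), and an agent is never worse than an earlier neighbour, whom it
could copy (`agentQuality_mono`).

Fix a set `A` of about `ε n` vertices. Suppose `v ∉ A` has `k` pairwise non-adjacent neighbours in
`A`. Let these leaves decide before everybody else, so that they follow their signals, and order the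
component of `v` outside `A` by distance from `v`. Then `v` errs with probability at most
`majorityRate q ^ k`, and this accuracy spreads along shortest paths to the whole component
(`exists_networkQuality_ge`).

With high probability two facts hold for `G(n, p)`. Since `n p → ∞`, any two disjoint sets of `⌊ε
n⌋` vertices are joined, so one component outside `A` misses few vertices. And most vertices outside
`A` are star centres (`eventually_noStar_le`): for small `p` by avoiding triangles, for larger `p`
by many independent trials, which is where `1 - p` must not decay polynomially. Hence some star
centre lies in the large component; a union bound combines the two facts. -/

namespace SocialLearning

/-! ### Accuracy of Bayesian agents -/

section Learning

variable {n : ℕ} {q : ℝ}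

lemma worldProb_nonneg (h0 : 0 ≤ q) (h1 : q ≤ 1) (ω : World n) : 0 ≤ worldProb q ω := by
  unfold worldProb
  refine mul_nonneg (by norm_num) (Finset.prod_nonneg fun v _ => ?_)
  split_ifs <;> linarith

lemma sum_prod_bool (h : Fin n → Bool → ℝ) :
    ∑ s : Fin n → Bool, ∏ v, h v (s v) = ∏ v, (h v true + h v false) := by
  have := Finset.prod_univ_sum (fun _ : Fin n => (Finset.univ : Finset Bool)) h
  rw [Fintype.piFinset_univ] at this
  simpa [-Fintype.univ_bool, Fintype.sum_bool] using this.symm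

/-- Expectation of a product of functions of the truth and of the single signals. -/
lemma sum_worldProb_mul_prod (g : Bool → Fin n → Bool → ℝ) :
    ∑ ω : World n, worldProb q ω * ∏ v, g ω.1 v (ω.2 v) =
      1 / 2 * ∑ t : Bool, ∏ v, (q * g t v t + (1 - q) * g t v (!t)) := by
  rw [Fintype.sum_prod_type, Finset.mul_sum]
  refine Finset.sum_congr rfl fun t _ => ?_
  have h := sum_prod_bool (fun v b => (if b = t then q else 1 - q) * g t v b)
  simp only [worldProb, mul_assoc]
  rw [← Finset.mul_sum]
  simp only [← Finset.prod_mul_distrib]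
  rw [h]
  congr 1
  refine Finset.prod_congr rfl fun v _ => ?_
  cases t <;> simp [add_comm]

lemma sum_worldProb : ∑ ω : World n, worldProb q ω = 1 := by
  have := sum_worldProb_mul_prod (n := n) (q := q) fun _ _ _ => 1
  simpa using this

lemma prob_add_prob_compl (E : Set (World n)) : prob q E + prob q Eᶜ = 1 := by
  classical
  rw [← sum_worldProb (n := n) (q := q), prob, prob, ← Finset.sum_add_distrib]
  refine Finset.sum_congr rfl fun ω _ => ?_
  by_cases h : ω ∈ E <;> simp [h]

lemma prob_nonneg (h0 : 0 ≤ q) (h1 : q ≤ 1) (E : Set (World n)) : 0 ≤ prob q E :=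
  Finset.sum_nonneg fun ω _ => by
    split_ifs
    exacts [worldProb_nonneg h0 h1 ω, le_rfl]

lemma prob_le_one (h0 : 0 ≤ q) (h1 : q ≤ 1) (E : Set (World n)) : prob q E ≤ 1 := by
  linarith [prob_add_prob_compl (q := q) E, prob_nonneg h0 h1 Eᶜ]

/-- Markov's inequality for a nonnegative product bounding the indicator of an event. -/
lemma prob_le_of_one_le_prod (h0 : 0 ≤ q) (h1 : q ≤ 1) (E : Set (World n))
    (g : Bool → Fin n → Bool → ℝ) (hg : ∀ t v b, 0 ≤ g t v b)
    (hE : ∀ ω ∈ E, 1 ≤ ∏ v, g ω.1 v (ω.2 v)) :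
    prob q E ≤ 1 / 2 * ∑ t : Bool, ∏ v, (q * g t v t + (1 - q) * g t v (!t)) := by
  classical
  rw [← sum_worldProb_mul_prod]
  refine Finset.sum_le_sum fun ω _ => ?_
  have hw := worldProb_nonneg h0 h1 ω
  split_ifs with h
  · exact le_mul_of_one_le_right hw (hE ω h)
  · exact mul_nonneg hw (Finset.prod_nonneg fun v _ => hg _ _ _)

lemma prob_truth_and_signal (t b : Bool) (v : Fin n) :
    prob q {ω : World n | ω.1 = t ∧ ω.2 v = b} = 1 / 2 * if b = t then q else 1 - q := by
  classical
  -- The indicator of the event is a product over agents whose only nontrivial factor is that of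
  -- `v`.
  have h := sum_worldProb_mul_prod (n := n) (q := q)
    fun t' u b' => if u = v then (if t' = t ∧ b' = b then 1 else 0) else 1
  simp only [Finset.prod_ite_eq', Finset.mem_univ, if_true] at h
  have e : ∀ t' : Bool, ∏ u : Fin n,
      (q * (if u = v then (if t' = t ∧ t' = b then 1 else 0) else 1) +
        (1 - q) * (if u = v then (if t' = t ∧ (!t') = b then 1 else 0) else 1)) =
      if t' = t then (if b = t then q else 1 - q) else 0 := by
    intro t'
    rw [Finset.prod_eq_single v]
    · cases t' <;> cases t <;> cases b <;> simp
    · intro u _ hu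
      simp [hu]
    · simp
  simp only [e] at h
  rw [prob]
  convert h using 1
  · refine Finset.sum_congr rfl fun ω _ => ?_
    by_cases h : ω.1 = t ∧ ω.2 v = b <;> simp [h]
  · cases t <;> simp

/-- What agent `v` observes, as a function of the private signals. -/
noncomputable def observation (q : ℝ) (τ : TieRule n) (G : SimpleGraph (Fin n))
    (σ : Equiv.Perm (Fin n)) (v : Fin n) (s : Fin n → Bool) : Observation n :=
  open Classical in
  (s v, fun u => if EarlierNbr G σ u v then some (action q τ G σ u s) else none)

lemma action_eq (τ : TieRule n) (G : SimpleGraph (Fin n)) (σ : Equiv.Perm (Fin n)) (v : Fin n)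
    (s : Fin n → Bool) :
    action q τ G σ v s = bayesDecision q (observation q τ G σ v) (observation q τ G σ v s)
      (τ G σ v (observation q τ G σ v s)) := by
  rw [action]
  simp only [observation, dite_eq_ite]
  rfl

/-- Optimality holds separately for each observation; in a tie both joint probabilities agree, so
`tie` is irrelevant. -/
lemma prob_le_prob_bayesDecision (obs : (Fin n → Bool) → Observation n) (x : Observation n)
    (tie b : Bool) :
    prob q {ω : World n | ω.1 = b ∧ obs ω.2 = x} ≤
      prob q {ω : World n | ω.1 = bayesDecision q obs x tie ∧ obs ω.2 = x} := by
  unfold bayesDecision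
  split_ifs with h1 h2
  · cases b
    exacts [h1.le, le_rfl]
  · cases b
    exacts [le_rfl, h2.le]
  · push Not at h1 h2
    cases b <;> cases tie
    exacts [le_rfl, h2, h1, le_rfl]

lemma prob_eq_sum_observation (obs : (Fin n → Bool) → Observation n) (f : Observation n → Bool) :
    prob q {ω : World n | f (obs ω.2) = ω.1} =
      ∑ x, prob q {ω : World n | ω.1 = f x ∧ obs ω.2 = x} := by
  classical
  simp only [prob]
  rw [Finset.sum_comm]
  refine Finset.sum_congr rfl fun ω _ => ?_
  rw [Finset.sum_eq_single (obs ω.2)]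
  · simp [eq_comm]
  · intro x _ hx
    simp [hx.symm]
  · simp

/-- The Bayesian decision is at least as accurate as any other function of the observation. -/
lemma prob_le_agentQuality (τ : TieRule n) (G : SimpleGraph (Fin n)) (σ : Equiv.Perm (Fin n))
    (v : Fin n) (f : Observation n → Bool) :
    prob q {ω : World n | f (observation q τ G σ v ω.2) = ω.1} ≤ agentQuality q τ G σ v := by
  unfold agentQuality
  simp only [action_eq]
  rw [prob_eq_sum_observation, prob_eq_sum_observation (observation q τ G σ v)
    (fun x => bayesDecision q (observation q τ G σ v) x (τ G σ v x))]
  exact Finset.sum_le_sum fun x _ => prob_le_prob_bayesDecision _ _ _ _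

/-- Copying `u` is a function of what `v` observes. The default in `getD` is never used, because the
action of `u` is visible. -/
lemma agentQuality_mono (τ : TieRule n) (G : SimpleGraph (Fin n)) (σ : Equiv.Perm (Fin n))
    {u v : Fin n} (h : EarlierNbr G σ u v) :
    agentQuality q τ G σ u ≤ agentQuality q τ G σ v := by
  have := prob_le_agentQuality (q := q) τ G σ v fun x => (x.2 u).getD false
  simpa [observation, h, agentQuality] using this

lemma agentQuality_le_one (h0 : 0 ≤ q) (h1 : q ≤ 1) (τ : TieRule n) (G : SimpleGraph (Fin n))
    (σ : Equiv.Perm (Fin n)) (v : Fin n) : agentQuality q τ G σ v ≤ 1 :=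
  prob_le_one h0 h1 _

lemma agentQuality_nonneg (h0 : 0 ≤ q) (h1 : q ≤ 1) (τ : TieRule n) (G : SimpleGraph (Fin n))
    (σ : Equiv.Perm (Fin n)) (v : Fin n) : 0 ≤ agentQuality q τ G σ v :=
  prob_nonneg h0 h1 _

/-- An agent without earlier neighbours follows its private signal. -/
lemma action_eq_signal (hq : 1 / 2 < q) (τ : TieRule n) (G : SimpleGraph (Fin n))
    (σ : Equiv.Perm (Fin n)) {v : Fin n} (h : ∀ u, ¬ EarlierNbr G σ u v) (s : Fin n → Bool) :
    action q τ G σ v s = s v := by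
  rw [action_eq]
  have hobs : ∀ s', observation q τ G σ v s' = (s' v, fun _ => none) := by
    intro s'
    simp [observation, h]
  have e : ∀ t : Bool, prob q {ω : World n | ω.1 = t ∧
      observation q τ G σ v ω.2 = observation q τ G σ v s} =
      1 / 2 * if s v = t then q else 1 - q := by
    intro t
    rw [← prob_truth_and_signal t (s v) v]
    simp [hobs]
  unfold bayesDecision
  rw [e, e]
  cases s v
  · simp only [reduceCtorEq, if_false, if_true]
    rw [if_neg (by linarith), if_pos (by linarith)]
  · simp only [reduceCtorEq, if_false, if_true]
    rw [if_pos (by linarith)]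

/-- The failure probability of a majority vote over `k` independent signals is at most the `k`-th
power of this rate. -/
noncomputable def majorityRate (q : ℝ) : ℝ := 1 / 2 + 2 * q * (1 - q)

lemma majorityRate_nonneg (hq : 1 / 2 < q) (h1 : q < 1) : 0 ≤ majorityRate q := by
  unfold majorityRate
  nlinarith

/-- The gap to `1` is `2 * (q - 1/2)^2`. -/
lemma majorityRate_lt_one (hq : 1 / 2 < q) : majorityRate q < 1 := by
  unfold majorityRate
  nlinarith [sq_pos_of_pos (sub_pos.2 hq)]

/-- Chernoff bound: weight a correct signal by `1/(2q)` and a wrong one by `2q ≥ 1`. When the vote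
is wrong, correct signals do not outnumber wrong ones, so the product of weights is at least `1`;
each weight has mean `majorityRate q`. -/
lemma prob_majority_wrong_le (hq : 1 / 2 < q) (h1 : q < 1) (S : Finset (Fin n)) :
    prob q {ω : World n | decide (S.card < 2 * (S.filter fun u => ω.2 u = true).card) ≠ ω.1} ≤
      majorityRate q ^ S.card := by
  classical
  have hq0 : 0 < q := by linarith
  refine (prob_le_of_one_le_prod hq0.le h1.le _
    (fun t v b => if v ∈ S then (if b = t then (2 * q)⁻¹ else 2 * q) else 1) ?_ ?_).trans_eq ?_
  · intro t v b
    split_ifs <;> positivity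
  · rintro ⟨t, s⟩ hω
    simp only [Finset.prod_ite_mem, Finset.univ_inter, Set.mem_ofPred_eq] at hω ⊢
    rw [Finset.prod_ite, Finset.prod_const, Finset.prod_const]
    set c := (S.filter fun u => s u = t).card with hc
    set d := (S.filter fun u => ¬ s u = t).card with hd
    have hcd : c + d = S.card := Finset.card_filter_add_card_filter_not _
    have hle : c ≤ d := by
      cases t
      · have : (S.filter fun u => s u = true).card = d := by
          rw [hd]; congr 1; ext u; simp
        rw [this] at hω
        simp at hω
        omega
      · rw [← hc] at hω
        simp at hω
        omega
    have h2 : 1 ≤ 2 * q := by linarith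
    rw [inv_pow]
    rw [← div_eq_inv_mul, one_le_div (by positivity)]
    exact pow_le_pow_right₀ h2 hle
  · have e : ∀ t : Bool, (∏ v : Fin n,
        (q * (if v ∈ S then (if t = t then (2 * q)⁻¹ else 2 * q) else 1) +
          (1 - q) * (if v ∈ S then (if (!t) = t then (2 * q)⁻¹ else 2 * q) else 1))) =
        majorityRate q ^ S.card := by
      intro t
      rw [← Finset.prod_const, ← Finset.univ_inter S, ← Finset.prod_ite_mem, Finset.univ_inter]
      refine Finset.prod_congr rfl fun v _ => ?_
      by_cases hv : v ∈ S
      · cases t <;> simp only [hv, if_true, reduceCtorEq, Bool.not_true, Bool.not_false,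
          if_false, majorityRate] <;> field_simp
      · simp [hv]
    rw [Finset.sum_congr rfl fun t _ => e t]
    simp

/-- An agent that sees `k` agents who follow their own signals is wrong with probability at most
`majorityRate q ^ k`. -/
lemma agentQuality_of_signal_followers (hq : 1 / 2 < q) (h1 : q < 1) (τ : TieRule n)
    (G : SimpleGraph (Fin n)) (σ : Equiv.Perm (Fin n)) {v : Fin n} {S : Finset (Fin n)}
    (hS : ∀ u ∈ S, EarlierNbr G σ u v) (hS' : ∀ u ∈ S, ∀ w, ¬ EarlierNbr G σ w u) :
    1 - majorityRate q ^ S.card ≤ agentQuality q τ G σ v := by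
  have h := prob_le_agentQuality (q := q) τ G σ v
    fun x => decide (S.card < 2 * (S.filter fun u => x.2 u = some true).card)
  have e : ∀ s : Fin n → Bool,
      (S.filter fun u => (observation q τ G σ v s).2 u = some true) =
        S.filter fun u => s u = true := by
    intro s
    refine Finset.filter_congr fun u hu => ?_
    simp [observation, hS u hu, action_eq_signal hq τ G σ (hS' u hu)]
  simp only [e] at h
  have h2 := prob_add_prob_compl (q := q)
    {ω : World n | decide (S.card < 2 * (S.filter fun u => ω.2 u = true).card) = ω.1}
  have h3 := prob_majority_wrong_le hq h1 S
  have h4 : {ω : World n | decide (S.card < 2 * (S.filter fun u => ω.2 u = true).card) = ω.1}ᶜ =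
    {ω : World n | decide (S.card < 2 * (S.filter fun u => ω.2 u = true).card) ≠ ω.1} := rfl
  rw [h4] at h2
  linarith

lemma networkQuality_le_one (h0 : 0 ≤ q) (h1 : q ≤ 1) (τ : TieRule n) (G : SimpleGraph (Fin n))
    (σ : Equiv.Perm (Fin n)) : networkQuality q τ G σ ≤ 1 := by
  unfold networkQuality
  have : ∑ v : Fin n, agentQuality q τ G σ v ≤ ∑ v : Fin n, (1 : ℝ) :=
    Finset.sum_le_sum fun v _ => agentQuality_le_one h0 h1 τ G σ v
  simp only [Finset.sum_const, Finset.card_univ, Fintype.card_fin, nsmul_eq_mul, mul_one] at this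
  rw [one_div, inv_mul_eq_div]
  exact div_le_one_of_le₀ this (Nat.cast_nonneg n)

lemma networkQuality_nonneg (h0 : 0 ≤ q) (h1 : q ≤ 1) (τ : TieRule n) (G : SimpleGraph (Fin n))
    (σ : Equiv.Perm (Fin n)) : 0 ≤ networkQuality q τ G σ :=
  mul_nonneg (by positivity) (Finset.sum_nonneg fun v _ => agentQuality_nonneg h0 h1 τ G σ v)

lemma networkQuality_le_optimalQuality (τ : TieRule n) (G : SimpleGraph (Fin n))
    (σ : Equiv.Perm (Fin n)) : networkQuality q τ G σ ≤ optimalQuality q τ G :=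
  le_ciSup (Set.finite_range _).bddAbove σ

lemma optimalQuality_le_one (h0 : 0 ≤ q) (h1 : q ≤ 1) (τ : TieRule n) (G : SimpleGraph (Fin n)) :
    optimalQuality q τ G ≤ 1 :=
  ciSup_le fun σ => networkQuality_le_one h0 h1 τ G σ

lemma optimalQuality_nonneg (h0 : 0 ≤ q) (h1 : q ≤ 1) (τ : TieRule n) (G : SimpleGraph (Fin n)) :
    0 ≤ optimalQuality q τ G :=
  (networkQuality_nonneg h0 h1 τ G 1).trans (networkQuality_le_optimalQuality τ G 1)

end Learning

/-! ### Decision orders and large components -/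

section Order

variable {n : ℕ}

/-- The graph obtained from `G` by isolating the vertices of `A`. -/
def isolate (G : SimpleGraph (Fin n)) (A : Finset (Fin n)) : SimpleGraph (Fin n) where
  Adj a b := G.Adj a b ∧ a ∉ A ∧ b ∉ A
  symm := ⟨fun _ _ h => ⟨h.1.symm, h.2.2, h.2.1⟩⟩
  loopless := ⟨fun _ h => G.loopless.irrefl _ h.1⟩

/-- `S` consists of `k` pairwise non-adjacent neighbours of `v` in `A`. -/
structure IsInducedStar (G : SimpleGraph (Fin n)) (A : Finset (Fin n)) (k : ℕ) (v : Fin n)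
    (S : Finset (Fin n)) : Prop where
  subset : S ⊆ A
  card_eq : S.card = k
  adj : ∀ u ∈ S, G.Adj v u
  not_adj : ∀ u ∈ S, ∀ w ∈ S, ¬ G.Adj u w

lemma exists_perm_sorting (key : Fin n → ℕ) :
    ∃ σ : Equiv.Perm (Fin n), ∀ u w, key u < key w → σ.symm u < σ.symm w := by
  refine ⟨Tuple.sort key, fun u w h => ?_⟩
  by_contra! hle
  have := Tuple.monotone_sort key hle
  simp only [Function.comp_apply, Equiv.apply_symm_apply] at this
  omega

/-- Take the second vertex of a shortest path from `w` to `v`. -/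
lemma exists_adj_dist_lt {V : Type*} {H : SimpleGraph V} {v w : V} (h : H.Reachable v w)
    (hne : w ≠ v) : ∃ u, H.Adj w u ∧ H.Reachable v u ∧ H.dist v u < H.dist v w := by
  obtain ⟨p, hp⟩ := h.symm.exists_walk_length_eq_dist
  cases p with
  | nil => exact absurd rfl hne
  | cons hadj p =>
    refine ⟨_, hadj, p.reachable.symm, ?_⟩
    rw [SimpleGraph.dist_comm (u := v) (v := w), ← hp, SimpleGraph.dist_comm]
    simpa using Nat.lt_succ_of_le (SimpleGraph.dist_le p)

open Classical in
/-- If `v` is the centre of an induced star with `k` leaves in `A`, then some decision order makes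
all vertices connected to `v` outside `A` as accurate as a majority vote over `k` signals. -/
lemma exists_networkQuality_ge {q : ℝ} (hq : 1 / 2 < q) (h1 : q < 1) (τ : TieRule n)
    (G : SimpleGraph (Fin n)) {A S : Finset (Fin n)} {k : ℕ} {v : Fin n} (hv : v ∉ A)
    (hS : IsInducedStar G A k v S) :
    ∃ σ, (Finset.univ.filter fun w => (isolate G A).Reachable v w).card / (n : ℝ) *
      (1 - majorityRate q ^ k) ≤ networkQuality q τ G σ := by
  -- Leaves get key `0`, all others at least `1`. Vertices not connected to `v` have `dist = 0` and
  -- tie with `v`; this is harmless, since extra earlier neighbours only add information.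
  obtain ⟨σ, hσ⟩ := exists_perm_sorting fun w => if w ∈ S then 0 else 1 + (isolate G A).dist v w
  have hSA : ∀ w, w ∉ A → w ∉ S := fun w hw h => hw (hS.subset h)
  have hvS : v ∉ S := hSA v hv
  have hcentre : 1 - majorityRate q ^ k ≤ agentQuality q τ G σ v := by
    rw [← hS.card_eq]
    refine agentQuality_of_signal_followers hq h1 τ G σ (fun u hu => ⟨hS.adj u hu, ?_⟩) ?_
    · apply hσ
      simp [hu, hvS]
    · rintro u hu w ⟨hadj, hlt⟩
      by_cases hw : w ∈ S
      · exact hS.not_adj u hu w hw hadj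
      · exact lt_asymm hlt (hσ u w (by simp [hu, hw]))
  have hreach : ∀ d w, (isolate G A).Reachable v w → (isolate G A).dist v w = d →
      1 - majorityRate q ^ k ≤ agentQuality q τ G σ w := by
    intro d
    induction d using Nat.strong_induction_on with
    | _ d ih =>
      intro w hw hd
      by_cases hwv : w = v
      · rwa [hwv]
      · obtain ⟨u, hadj, hu, hlt⟩ := exists_adj_dist_lt hw hwv
        refine (ih _ (hd ▸ hlt) u hu rfl).trans (agentQuality_mono τ G σ ⟨hadj.1, hσ u w ?_⟩)
        simpa [hSA u hadj.2.2, hSA w hadj.2.1] using hlt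
  refine ⟨σ, ?_⟩
  have hsum : (Finset.univ.filter fun w => (isolate G A).Reachable v w).card *
      (1 - majorityRate q ^ k) ≤ ∑ w, agentQuality q τ G σ w := by
    calc _ = ∑ w ∈ Finset.univ.filter fun w => (isolate G A).Reachable v w,
          (1 - majorityRate q ^ k) := by rw [Finset.sum_const, nsmul_eq_mul]
      _ ≤ ∑ w ∈ Finset.univ.filter fun w => (isolate G A).Reachable v w,
          agentQuality q τ G σ w :=
        Finset.sum_le_sum fun w hw => hreach _ w (Finset.mem_filter.1 hw).2 rfl
      _ ≤ _ := Finset.sum_le_univ_sum_of_nonneg fun w =>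
        agentQuality_nonneg (by linarith) h1.le τ G σ w
  unfold networkQuality
  calc _ = 1 / (n : ℝ) * ((Finset.univ.filter fun w => (isolate G A).Reachable v w).card *
        (1 - majorityRate q ^ k)) := by ring
    _ ≤ _ := mul_le_mul_of_nonneg_left hsum (by positivity)

/-- Any two disjoint sets of at least `m` vertices are joined by an edge. -/
def Expands (G : SimpleGraph (Fin n)) (m : ℕ) : Prop :=
  ∀ U W : Finset (Fin n), Disjoint U W → m ≤ U.card → m ≤ W.card → ∃ u ∈ U, ∃ w ∈ W, G.Adj u w

open Classical in
/-- In an expanding graph, some component outside `A` misses fewer than `m` vertices. -/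
lemma Expands.exists_large_component {G : SimpleGraph (Fin n)} {m : ℕ} (hG : Expands G m)
    (A : Finset (Fin n)) (hA : A.card + 3 * m ≤ n) {W : Finset (Fin n)} (hW : Disjoint W A)
    (hWm : m < W.card) :
    ∃ v ∈ W, n ≤ (Finset.univ.filter fun w => (isolate G A).Reachable v w).card + A.card + m := by
  -- These are the unions of components outside `A` with at least `m` vertices. A smallest one, `U`,
  -- sends no edge to the rest of `Aᶜ`, so expansion leaves fewer than `m` vertices there.
  let closed : Finset (Finset (Fin n)) := Aᶜ.powerset.filter fun U =>
    m ≤ U.card ∧ ∀ a ∈ U, ∀ b, (isolate G A).Adj a b → b ∈ U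
  have hAc : Aᶜ.card + A.card = n := by
    have := (add_comm _ _).trans (Finset.card_add_card_compl A)
    rwa [Fintype.card_fin] at this
  have hne : closed.Nonempty := ⟨Aᶜ, by
    simp only [closed, Finset.mem_filter, Finset.mem_powerset, subset_refl, true_and]
    exact ⟨by omega, fun a _ b hab => Finset.mem_compl.2 hab.2.2⟩⟩
  obtain ⟨U, hU, hmin⟩ := closed.exists_min_image Finset.card hne
  simp only [closed, Finset.mem_filter, Finset.mem_powerset] at hU hmin
  obtain ⟨hUA, hUm, hUcl⟩ := hU
  have hUreach : ∀ a ∈ U, ∀ b, (isolate G A).Reachable a b → b ∈ U := by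
    rintro a ha b ⟨p⟩
    induction p with
    | nil => exact ha
    | cons h p ih => exact ih (hUcl _ ha _ h)
  have hUlarge : (Aᶜ \ U).card < m := by
    by_contra! hle
    obtain ⟨u, hu, w, hw, hadj⟩ := hG U (Aᶜ \ U) Finset.disjoint_sdiff hUm hle
    have hw' := Finset.mem_sdiff.1 hw
    exact hw'.2 (hUcl u hu w ⟨hadj, Finset.mem_compl.1 (hUA hu), Finset.mem_compl.1 hw'.1⟩)
  have hUcard : (Aᶜ \ U).card + U.card = Aᶜ.card := Finset.card_sdiff_add_card_eq_card hUA
  obtain ⟨v, hv⟩ : (W ∩ U).Nonempty := by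
    by_contra hempty
    rw [Finset.not_nonempty_iff_eq_empty] at hempty
    have : W ⊆ Aᶜ \ U := fun w hw => Finset.mem_sdiff.2
      ⟨Finset.mem_compl.2 (Finset.disjoint_left.1 hW hw), fun hwU => by
        have : w ∈ W ∩ U := Finset.mem_inter.2 ⟨hw, hwU⟩
        simp [hempty] at this⟩
    have := Finset.card_le_card this
    omega
  obtain ⟨hvW, hvU⟩ := Finset.mem_inter.1 hv
  refine ⟨v, hvW, ?_⟩
  set K := Finset.univ.filter fun w => (isolate G A).Reachable v w with hK
  have hKU : K ⊆ U := fun w hw => hUreach v hvU w (Finset.mem_filter.1 hw).2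
  have hKcl : ∀ a ∈ K, ∀ b, (isolate G A).Adj a b → b ∈ K := fun a ha b hab =>
    Finset.mem_filter.2 ⟨Finset.mem_univ _, (Finset.mem_filter.1 ha).2.trans hab.reachable⟩
  have hKcard : (U \ K).card + K.card = U.card := Finset.card_sdiff_add_card_eq_card hKU
  have hKpos : 0 < K.card := Finset.card_pos.2 ⟨v, by simp [hK]⟩
  -- Minimality forces the component `K` to be all of `U`: if `K` had fewer than `m` vertices, then
  -- `U \ K` would be a smaller closed set, still of size at least `m` because `U` has more than `2
  -- * m`.
  by_cases h1 : m ≤ K.card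
  · have := hmin K ⟨hKU.trans hUA, h1, hKcl⟩
    omega
  · have h2 : m ≤ (U \ K).card := by omega
    have := hmin (U \ K) ⟨Finset.sdiff_subset.trans hUA, h2, fun a ha b hab => by
      rw [Finset.mem_sdiff] at ha ⊢
      exact ⟨hUcl a ha.1 b hab, fun hb => ha.2 (hKcl b hb a hab.symm)⟩⟩
    omega

end Order

/-! ### Probability bounds for fixed `n` and `p` -/

section RandomGraph

open MeasureTheory ProbabilityTheory SimpleGraph

variable {n : ℕ} {p : unitInterval}

instance : DiscreteMeasurableSpace (SimpleGraph (Fin n)) where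
  forall_measurableSet S := by
    rw [← Set.preimage_image_eq S SimpleGraph.edgeSet_injective]
    exact measurableEmbedding_edgeSet.measurable MeasurableSet.of_discrete

/-- The event is a cylinder of the product measure on pairs. Diagonal pairs are excluded because
`fromEdgeSet` discards them. -/
lemma binomialRandom_real_edge_pattern (F : Finset (Sym2 (Fin n))) (hF : ∀ e ∈ F, ¬ e.IsDiag)
    (π : Sym2 (Fin n) → Prop) [DecidablePred π] :
    (binomialRandom (Fin n) p).real {G | ∀ e ∈ F, (e ∈ G.edgeSet ↔ π e)} =
      ∏ e ∈ F, if π e then (p : ℝ) else 1 - p := by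
  rw [measureReal_def, binomialRandom_eq_map,
    Measure.map_apply measurable_fromEdgeSet (MeasurableSet.of_discrete),
    setBernoulli_eq_map, Measure.map_apply (by fun_prop) (MeasurableSet.of_discrete)]
  have : ((fun P : Sym2 (Fin n) → Prop => {i | P i}) ⁻¹' (fromEdgeSet ⁻¹'
      {G : SimpleGraph (Fin n) | ∀ e ∈ F, (e ∈ G.edgeSet ↔ π e)})) =
      Set.pi (F : Set (Sym2 (Fin n))) fun e => {π e} := by
    ext P
    simp only [Set.mem_preimage, Set.mem_ofPred_eq, Set.mem_pi, Finset.mem_coe,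
      Set.mem_singleton_iff, edgeSet_fromEdgeSet, eq_iff_iff]
    refine forall₂_congr fun e he => ?_
    have := hF e he
    simp [this]
  rw [this, Measure.infinitePi_pi _ (fun _ _ => MeasurableSet.of_discrete), ENNReal.toReal_prod]
  refine Finset.prod_congr rfl fun e he => ?_
  have := hF e he
  by_cases h : π e <;> simp [h, this]

lemma binomialRandom_real_disjoint_edges (F : Finset (Sym2 (Fin n))) (hF : ∀ e ∈ F, ¬ e.IsDiag) :
    (binomialRandom (Fin n) p).real {G | ∀ e ∈ F, e ∉ G.edgeSet} = (1 - p : ℝ) ^ F.card := by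
  have := binomialRandom_real_edge_pattern (p := p) F hF fun _ => False
  simpa using this

lemma binomialRandom_real_subset_edges (F : Finset (Sym2 (Fin n))) (hF : ∀ e ∈ F, ¬ e.IsDiag) :
    (binomialRandom (Fin n) p).real {G | ∀ e ∈ F, e ∈ G.edgeSet} = (p : ℝ) ^ F.card := by
  have := binomialRandom_real_edge_pattern (p := p) F hF fun _ => True
  simpa using this

lemma one_sub_coe_nonneg : 0 ≤ 1 - (p : ℝ) := sub_nonneg.2 p.2.2

lemma one_sub_coe_le_one : 1 - (p : ℝ) ≤ 1 := by linarith [p.2.1]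

lemma binomialRandom_real_no_edge_between (U W : Finset (Fin n)) (h : Disjoint U W) :
    (binomialRandom (Fin n) p).real {G | ∀ u ∈ U, ∀ w ∈ W, ¬ G.Adj u w} =
      (1 - p : ℝ) ^ (U.card * W.card) := by
  classical
  have hne : ∀ u ∈ U, ∀ w ∈ W, u ≠ w := fun u hu w hw => Finset.disjoint_iff_ne.1 h u hu w hw
  have := binomialRandom_real_disjoint_edges (p := p)
    ((U ×ˢ W).image fun x => s(x.1, x.2)) (by
      intro e he
      obtain ⟨⟨u, w⟩, hx, rfl⟩ := Finset.mem_image.1 he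
      rw [Finset.mem_product] at hx
      simpa using hne u hx.1 w hx.2)
  rw [Finset.card_image_of_injOn, Finset.card_product] at this
  · rw [← this]
    congr 1
    ext G
    simp only [Set.mem_ofPred_eq, Finset.forall_mem_image, Finset.mem_product, Prod.forall,
      mem_edgeSet]
    exact ⟨fun h a b hab => h a hab.1 b hab.2, fun h a ha b hb => h a b ⟨ha, hb⟩⟩
  · rintro ⟨a, b⟩ hab ⟨c, d⟩ hcd heq
    simp only [Finset.coe_product, Set.mem_prod, Finset.mem_coe] at hab hcd
    rcases Sym2.eq_iff.1 heq with h' | h'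
    · exact Prod.ext h'.1 h'.2
    · exact absurd h'.1 (hne a hab.1 d hcd.2)

/-- Union bound over the at most `4 ^ n` pairs of vertex sets. -/
lemma binomialRandom_real_not_expands_le (m : ℕ) :
    (binomialRandom (Fin n) p).real {G | ¬ Expands G m} ≤ 4 ^ n * (1 - p : ℝ) ^ (m * m) := by
  classical
  let I : Finset (Finset (Fin n) × Finset (Fin n)) := Finset.univ.filter fun x =>
    Disjoint x.1 x.2 ∧ m ≤ x.1.card ∧ m ≤ x.2.card
  have hsub : {G : SimpleGraph (Fin n) | ¬ Expands G m} ⊆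
      ⋃ x ∈ I, {G | ∀ u ∈ x.1, ∀ w ∈ x.2, ¬ G.Adj u w} := by
    intro G hG
    simp only [Expands, Set.mem_ofPred_eq] at hG
    push Not at hG
    obtain ⟨U, W, h1, h2, h3, h4⟩ := hG
    simp only [Set.mem_iUnion]
    exact ⟨(U, W), Finset.mem_filter.2 ⟨Finset.mem_univ _, h1, h2, h3⟩, h4⟩
  calc _ ≤ _ := measureReal_mono hsub (measure_ne_top _ _)
    _ ≤ ∑ x ∈ I, (binomialRandom (Fin n) p).real {G | ∀ u ∈ x.1, ∀ w ∈ x.2, ¬ G.Adj u w} :=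
      measureReal_biUnion_finset_le _ _
    _ ≤ ∑ x ∈ I, (1 - p : ℝ) ^ (m * m) := by
      refine Finset.sum_le_sum fun x hx => ?_
      obtain ⟨h1, h2, h3⟩ := (Finset.mem_filter.1 hx).2
      rw [binomialRandom_real_no_edge_between _ _ h1]
      exact pow_le_pow_of_le_one one_sub_coe_nonneg one_sub_coe_le_one (Nat.mul_le_mul h2 h3)
    _ = I.card * (1 - p : ℝ) ^ (m * m) := by rw [Finset.sum_const, nsmul_eq_mul]
    _ ≤ _ := by
      refine mul_le_mul_of_nonneg_right ?_ (pow_nonneg one_sub_coe_nonneg _)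
      have : I.card ≤ 4 ^ n := by
        refine (Finset.card_le_univ I).trans_eq ?_
        simp [Fintype.card_prod, ← mul_pow]
      exact_mod_cast this

lemma exists_grid {A : Finset (Fin n)} {a b : ℕ} (h : a * b ≤ A.card) :
    ∃ f : Fin a × Fin b → Fin n, Function.Injective f ∧ ∀ x, f x ∈ A := by
  obtain ⟨g⟩ : Nonempty (Fin a × Fin b ↪ A) := Function.Embedding.nonempty_of_card_le (by simpa)
  exact ⟨fun x => g x, Subtype.val_injective.comp g.injective, fun x => (g x).2⟩

/-- There are no `k` pairwise non-adjacent neighbours of `v` in `A`. -/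
def noStar (A : Finset (Fin n)) (k : ℕ) (v : Fin n) : Set (SimpleGraph (Fin n)) :=
  {G | ¬ ∃ S, IsInducedStar G A k v S}

/-- A bound that is useful for sparse graphs: each of `k` blocks of `l` vertices contains a
neighbour of `v`, and `v` is in no triangle with vertices of these blocks. -/
lemma binomialRandom_real_noStar_le_sparse {A : Finset (Fin n)} {v : Fin n} (hv : v ∉ A)
    {k l : ℕ} (h : k * l ≤ A.card) :
    (binomialRandom (Fin n) p).real (noStar A k v) ≤
      k * (1 - p : ℝ) ^ l + (k * l : ℝ) ^ 2 * (p : ℝ) ^ 3 := by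
  classical
  obtain ⟨f, hf, hfA⟩ := exists_grid h
  have hvf : ∀ x, v ≠ f x := fun x hx => hv (hx ▸ hfA x)
  -- `E1 i`: block `i` contains no neighbour of `v`. `E2 x`: `v` forms a triangle with two grid
  -- vertices. If none occurs, one neighbour from each block gives the star.
  let E1 : Fin k → Set (SimpleGraph (Fin n)) := fun i => {G | ∀ j, ¬ G.Adj v (f (i, j))}
  let E2 : (Fin k × Fin l) × (Fin k × Fin l) → Set (SimpleGraph (Fin n)) := fun x =>
    {G | G.Adj v (f x.1) ∧ G.Adj v (f x.2) ∧ G.Adj (f x.1) (f x.2)}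
  have hsub : noStar A k v ⊆ (⋃ i ∈ (Finset.univ : Finset (Fin k)), E1 i) ∪
      ⋃ x ∈ (Finset.univ : Finset ((Fin k × Fin l) × (Fin k × Fin l))), E2 x := by
    intro G hG
    by_contra hcon
    simp only [Set.mem_union, Set.mem_iUnion, Finset.mem_univ, exists_true_left, E1, E2,
      Set.mem_ofPred_eq] at hcon
    push Not at hcon
    obtain ⟨h1, h2⟩ := hcon
    choose j hj using h1
    refine hG ⟨Finset.univ.image fun i => f (i, j i), ?_, ?_, ?_, ?_⟩
    · intro u hu
      obtain ⟨i, -, rfl⟩ := Finset.mem_image.1 hu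
      exact hfA _
    · rw [Finset.card_image_of_injective, Finset.card_univ, Fintype.card_fin]
      intro a b hab
      exact congrArg Prod.fst (hf hab)
    · intro u hu
      obtain ⟨i, -, rfl⟩ := Finset.mem_image.1 hu
      exact hj i
    · intro u hu w hw
      obtain ⟨i, -, rfl⟩ := Finset.mem_image.1 hu
      obtain ⟨i', -, rfl⟩ := Finset.mem_image.1 hw
      exact h2 ((i, j i), (i', j i')) (hj i) (hj i')
  have hE1 : ∀ i, (binomialRandom (Fin n) p).real (E1 i) = (1 - p : ℝ) ^ l := by
    intro i
    have hinj : Function.Injective fun j => f (i, j) := fun a b hab =>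
      congrArg Prod.snd (hf hab)
    have := binomialRandom_real_no_edge_between (p := p) {v}
      (Finset.univ.image fun j => f (i, j)) (by
        rw [Finset.disjoint_singleton_left, Finset.mem_image]
        rintro ⟨j, -, hj⟩
        exact hvf _ hj.symm)
    rw [Finset.card_image_of_injective _ hinj] at this
    simpa [E1] using this
  have hE2 : ∀ x, (binomialRandom (Fin n) p).real (E2 x) ≤ (p : ℝ) ^ 3 := by
    rintro ⟨x, y⟩
    by_cases hxy : x = y
    · have : E2 (x, y) = ∅ := by
        ext G
        simp [E2, hxy]
      rw [this, measureReal_empty]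
      exact pow_nonneg p.2.1 3
    · have hxy' : f x ≠ f y := fun h => hxy (hf h)
      have := binomialRandom_real_subset_edges (p := p)
        {s(v, f x), s(v, f y), s(f x, f y)} (by simp [hvf, hxy'])
      rw [Finset.card_eq_three.2 ⟨s(v, f x), s(v, f y), s(f x, f y), by
        simp [hvf, hxy', (hvf _).symm], by simp [hvf, hxy'], by simp [hvf], rfl⟩] at this
      rw [← this]
      refine measureReal_mono fun G hG => ?_
      simpa [E2] using hG
  calc _ ≤ _ := measureReal_mono hsub (measure_ne_top _ _)
    _ ≤ _ := measureReal_union_le _ _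
    _ ≤ ∑ i, (binomialRandom (Fin n) p).real (E1 i) +
        ∑ x, (binomialRandom (Fin n) p).real (E2 x) :=
      add_le_add (measureReal_biUnion_finset_le _ _) (measureReal_biUnion_finset_le _ _)
    _ ≤ ∑ _i : Fin k, (1 - p : ℝ) ^ l +
        ∑ _x : (Fin k × Fin l) × (Fin k × Fin l), (p : ℝ) ^ 3 :=
      add_le_add (Finset.sum_le_sum fun i _ => (hE1 i).le) (Finset.sum_le_sum fun x _ => hE2 x)
    _ = _ := by
      simp [sq]

/-- A bound that is useful for dense graphs: `L` disjoint sets of `k` vertices are independently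
the leaves of an induced star with centre `v`. -/
lemma binomialRandom_real_noStar_le_dense {A : Finset (Fin n)} {v : Fin n} (hv : v ∉ A)
    {k L : ℕ} (h : L * k ≤ A.card) :
    (binomialRandom (Fin n) p).real (noStar A k v) ≤
      (1 - (p : ℝ) ^ k * (1 - p : ℝ) ^ (k * k)) ^ L := by
  classical
  obtain ⟨f, hf, hfA⟩ := exists_grid h
  have hvf : ∀ x, v ≠ f x := fun x hx => hv (hx ▸ hfA x)
  let F1 : Fin L → Finset (Sym2 (Fin n)) := fun i => Finset.univ.image fun j => s(v, f (i, j))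
  let F2 : Fin L → Finset (Sym2 (Fin n)) := fun i =>
    (Finset.univ : Finset (Fin k)).offDiag.image fun j => s(f (i, j.1), f (i, j.2))
  let F : Fin L → Finset (Sym2 (Fin n)) := fun i => F1 i ∪ F2 i
  -- On the pairs in `F i`, the pattern `v ∈ e` prescribes exactly the spokes as edges and the pairs
  -- of leaves as non-edges.
  let E : Fin L → Set (SimpleGraph (Fin n)) := fun i => {G | ∀ e ∈ F i, (e ∈ G.edgeSet ↔ v ∈ e)}
  have hdiag : ∀ i, ∀ e ∈ F i, ¬ e.IsDiag := by
    intro i e he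
    rcases Finset.mem_union.1 he with he | he
    · obtain ⟨j, -, rfl⟩ := Finset.mem_image.1 he
      simpa using hvf _
    · obtain ⟨⟨j, j'⟩, hj, rfl⟩ := Finset.mem_image.1 he
      simp only [Finset.mem_offDiag] at hj
      simp only [Sym2.mk_isDiag_iff]
      exact fun hcon => hj.2.2 (congrArg Prod.snd (hf hcon))
  have hmem : ∀ i, ∀ e ∈ F i, ∃ j, f (i, j) ∈ e ∧ ∀ x, f x ∈ e → x.1 = i := by
    intro i e he
    rcases Finset.mem_union.1 he with he | he
    · obtain ⟨j, -, rfl⟩ := Finset.mem_image.1 he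
      refine ⟨j, by simp, fun x hx => ?_⟩
      rcases Sym2.mem_iff.1 hx with hx | hx
      · exact absurd hx.symm (hvf x)
      · rw [hf hx]
    · obtain ⟨⟨j, j'⟩, hj, rfl⟩ := Finset.mem_image.1 he
      refine ⟨j, by simp, fun x hx => ?_⟩
      rcases Sym2.mem_iff.1 hx with hx | hx <;> rw [hf hx]
  -- Each pair in `F i` contains a vertex of row `i` and none of another row; disjointness of the `F
  -- i` yields independence of the `E i`.
  have hdisj : ∀ i i', i ≠ i' → Disjoint (F i) (F i') := by
    intro i i' hii'
    refine Finset.disjoint_left.2 fun e he he' => hii' ?_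
    obtain ⟨j, hj, -⟩ := hmem i e he
    obtain ⟨-, -, h2⟩ := hmem i' e he'
    exact h2 _ hj
  have hindep : iIndepSet E (binomialRandom (Fin n) p) := by
    rw [iIndepSet_iff_meas_biInter fun _ => MeasurableSet.of_discrete]
    intro s
    rw [← ENNReal.toReal_eq_toReal_iff' (measure_ne_top _ _)
      (ENNReal.prod_ne_top fun _ _ => measure_ne_top _ _), ENNReal.toReal_prod]
    have h1 := binomialRandom_real_edge_pattern (p := p) (s.biUnion F)
      (fun e he => by
        obtain ⟨i, -, hi⟩ := Finset.mem_biUnion.1 he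
        exact hdiag i e hi) (fun e => v ∈ e)
    rw [Finset.prod_biUnion fun i _ i' _ hne => hdisj i i' hne] at h1
    have h2 : ∀ i, (binomialRandom (Fin n) p).real (E i) =
        ∏ e ∈ F i, if v ∈ e then (p : ℝ) else 1 - p := fun i =>
      binomialRandom_real_edge_pattern (p := p) (F i) (hdiag i) fun e => v ∈ e
    simp only [← h2] at h1
    refine Eq.trans ?_ h1
    rw [measureReal_def]
    congr 2
    ext G
    simp only [E, Set.mem_iInter, Set.mem_ofPred_eq, Finset.mem_biUnion]
    exact ⟨fun h e ⟨i, hi, he⟩ => h i hi e he, fun h i hi e he => h e ⟨i, hi, he⟩⟩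
  have hE : ∀ i, (p : ℝ) ^ k * (1 - p : ℝ) ^ (k * k) ≤ (binomialRandom (Fin n) p).real (E i) := by
    intro i
    have hF : Disjoint (F1 i) (F2 i) := by
      refine Finset.disjoint_left.2 fun e he he' => ?_
      obtain ⟨j, -, rfl⟩ := Finset.mem_image.1 he
      obtain ⟨j', -, he'⟩ := Finset.mem_image.1 he'
      have hv : v ∈ s(f (i, j'.1), f (i, j'.2)) := he' ▸ Sym2.mem_mk_left _ _
      rcases Sym2.mem_iff.1 hv with h | h
      exacts [hvf _ h, hvf _ h]
    rw [binomialRandom_real_edge_pattern (p := p) (F i) (hdiag i) fun e => v ∈ e,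
      Finset.prod_union hF]
    have e1 : ∏ e ∈ F1 i, (if v ∈ e then (p : ℝ) else 1 - p) = (p : ℝ) ^ (F1 i).card := by
      refine Finset.prod_eq_pow_card fun e he => ?_
      obtain ⟨j, -, rfl⟩ := Finset.mem_image.1 he
      simp
    have e2 : ∏ e ∈ F2 i, (if v ∈ e then (p : ℝ) else 1 - p) = (1 - p : ℝ) ^ (F2 i).card := by
      refine Finset.prod_eq_pow_card fun e he => ?_
      obtain ⟨j, -, rfl⟩ := Finset.mem_image.1 he
      simp [hvf]
    rw [e1, e2]
    -- Upper bounds on the numbers of pairs suffice, since both bases lie in `[0, 1]`; `k * k` is a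
    -- crude count of the leaf pairs.
    have c1 : (F1 i).card ≤ k := Finset.card_image_le.trans_eq (by simp)
    have c2 : (F2 i).card ≤ k * k := Finset.card_image_le.trans (by
      rw [Finset.offDiag_card]; simp)
    exact mul_le_mul (pow_le_pow_of_le_one p.2.1 p.2.2 c1)
      (pow_le_pow_of_le_one one_sub_coe_nonneg one_sub_coe_le_one c2)
      (pow_nonneg one_sub_coe_nonneg _) (pow_nonneg p.2.1 _)
  have hsub : noStar A k v ⊆ ⋂ i, (E i)ᶜ := by
    intro G hG
    simp only [Set.mem_iInter, Set.mem_compl_iff]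
    intro i hGi
    have hinj : Function.Injective fun j => f (i, j) := fun a b hab =>
      congrArg Prod.snd (hf hab)
    refine hG ⟨Finset.univ.image fun j => f (i, j), ?_, ?_, ?_, ?_⟩
    · intro u hu
      obtain ⟨j, -, rfl⟩ := Finset.mem_image.1 hu
      exact hfA _
    · rw [Finset.card_image_of_injective _ hinj, Finset.card_univ, Fintype.card_fin]
    · intro u hu
      obtain ⟨j, -, rfl⟩ := Finset.mem_image.1 hu
      have := hGi s(v, f (i, j)) (Finset.mem_union_left _
        (Finset.mem_image.2 ⟨j, Finset.mem_univ _, rfl⟩))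
      simpa using this
    · intro u hu w hw
      obtain ⟨j, -, rfl⟩ := Finset.mem_image.1 hu
      obtain ⟨j', -, rfl⟩ := Finset.mem_image.1 hw
      by_cases hjj : j = j'
      · simp [hjj]
      · have := hGi s(f (i, j), f (i, j')) (Finset.mem_union_right _
          (Finset.mem_image.2 ⟨(j, j'), by simpa using hjj, rfl⟩))
        simpa [hvf] using this
  have hprod : (binomialRandom (Fin n) p).real (⋂ i, (E i)ᶜ) =
      ∏ i, (1 - (binomialRandom (Fin n) p).real (E i)) := by
    rw [measureReal_def, (iIndepSet_iff_iIndep _ _).1 hindep |>.meas_iInter fun i =>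
      (MeasurableSpace.measurableSet_generateFrom (Set.mem_singleton _)).compl, ENNReal.toReal_prod]
    refine Finset.prod_congr rfl fun i _ => ?_
    rw [← measureReal_def, probReal_compl_eq_one_sub MeasurableSet.of_discrete]
  calc _ ≤ _ := measureReal_mono hsub (measure_ne_top _ _)
    _ = _ := hprod
    _ ≤ ∏ _i : Fin L, (1 - (p : ℝ) ^ k * (1 - p : ℝ) ^ (k * k)) :=
      Finset.prod_le_prod (fun i _ => sub_nonneg.2 measureReal_le_one)
        fun i _ => sub_le_sub_left (hE i) 1
    _ = _ := by simp

/-- Markov's inequality for the number of events that occur. -/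
lemma mul_measureReal_card_filter_ge_le {Ω ι : Type*} [MeasurableSpace Ω]
    [DiscreteMeasurableSpace Ω] [Finite Ω] (μ : Measure Ω) [IsProbabilityMeasure μ]
    (I : Finset ι) (E : ι → Set Ω) [∀ ω, DecidablePred fun i => ω ∈ E i] (t : ℕ) :
    t * μ.real {ω | t ≤ (I.filter fun i => ω ∈ E i).card} ≤ ∑ i ∈ I, μ.real (E i) := by
  classical
  have h := mul_meas_ge_le_integral_of_nonneg (μ := μ)
    (f := fun ω => ∑ i ∈ I, (E i).indicator (fun _ => (1 : ℝ)) ω)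
    (Eventually.of_forall fun ω => Finset.sum_nonneg fun i _ =>
      Set.indicator_nonneg (fun _ _ => zero_le_one) ω) Integrable.of_finite t
  rw [integral_finsetSum _ fun _ _ => Integrable.of_finite] at h
  simp only [integral_indicator_one MeasurableSet.of_discrete, ← Pi.one_def] at h
  convert h using 3
  ext ω
  simp [Set.indicator_apply, Finset.sum_boole]

end RandomGraph

/-! ### Limits as `n → ∞` -/

section Asymptotic

open MeasureTheory ProbabilityTheory SimpleGraph

lemma one_sub_pow_le_exp {x : ℝ} (hx : x ≤ 1) (l : ℕ) : (1 - x) ^ l ≤ Real.exp (-(x * l)) := by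
  calc (1 - x) ^ l ≤ Real.exp (-x) ^ l :=
        pow_le_pow_left₀ (sub_nonneg.2 hx) (by linarith [Real.add_one_le_exp (-x)]) l
    _ = _ := by rw [← Real.exp_nat_mul]; ring_nf

lemma eventually_le_of_one_isLittleO {f : ℕ → ℝ} (hf : ∀ n, 0 ≤ f n)
    (h : (fun _ : ℕ => (1 : ℝ)) =o[atTop] f) (C : ℝ) : ∀ᶠ n in atTop, C ≤ f n := by
  have h1 := (isLittleO_one_left_iff ℝ).1 h
  filter_upwards [h1.eventually_ge_atTop C] with n hn
  rwa [Real.norm_of_nonneg (hf n)] at hn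

variable {p : ℕ → unitInterval}

lemma eventually_le_mul_prob (hp : (fun _ : ℕ => (1 : ℝ)) =o[atTop] fun n : ℕ => (n : ℝ) * (p n : ℝ))
    (C : ℝ) : ∀ᶠ n : ℕ in atTop, C ≤ n * (p n : ℝ) :=
  eventually_le_of_one_isLittleO (fun n => mul_nonneg n.cast_nonneg (p n).2.1) hp C

/-- With `m ≥ ε n / 2` and `n p ≥ 12 / ε ^ 2` one has `p m ^ 2 ≥ 3 n`, which beats `4 ^ n ≤ exp (2
n)` and leaves `exp (-n)`. -/
lemma eventually_not_expands_le
    (hp : (fun _ : ℕ => (1 : ℝ)) =o[atTop] fun n : ℕ => (n : ℝ) * (p n : ℝ))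
    {ε : ℝ} (hε : 0 < ε) :
    ∀ᶠ n : ℕ in atTop,
      (binomialRandom (Fin n) (p n)).real {G | ¬ Expands G ⌊ε * n⌋₊} ≤ ε := by
  have hexp : Tendsto (fun n : ℕ => Real.exp (-(n : ℝ))) atTop (𝓝 0) :=
    Real.tendsto_exp_neg_atTop_nhds_zero.comp tendsto_natCast_atTop_atTop
  filter_upwards [eventually_le_mul_prob hp (12 / ε ^ 2), hexp.eventually_le_const hε,
    tendsto_natCast_atTop_atTop.eventually_ge_atTop (2 / ε)] with n h1 h2 h3
  have hm : ε * n / 2 ≤ (⌊ε * n⌋₊ : ℝ) := by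
    have := Nat.lt_floor_add_one (ε * n)
    have h4 : 2 ≤ ε * n := by rwa [div_le_iff₀' hε] at h3
    linarith
  refine (binomialRandom_real_not_expands_le _).trans (le_trans ?_ h2)
  have h4 : (4 : ℝ) ^ n ≤ Real.exp (2 * n) := by
    rw [mul_comm, Real.exp_nat_mul]
    refine pow_le_pow_left₀ (by norm_num) ?_ n
    have := Real.exp_one_gt_d9
    have e : Real.exp 2 = Real.exp 1 * Real.exp 1 := by rw [← Real.exp_add]; norm_num
    nlinarith
  have h5 := one_sub_pow_le_exp (p n).2.2 (⌊ε * n⌋₊ * ⌊ε * n⌋₊)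
  have h6 : (3 : ℝ) * n ≤ (p n : ℝ) * ((⌊ε * n⌋₊ * ⌊ε * n⌋₊ : ℕ) : ℝ) := by
    push_cast
    have hn : (0 : ℝ) ≤ n := n.cast_nonneg
    have hsq : ε * n / 2 * (ε * n / 2) ≤ (⌊ε * n⌋₊ : ℝ) * ⌊ε * n⌋₊ :=
      mul_le_mul hm hm (by positivity) (by positivity)
    rw [div_le_iff₀ (by positivity)] at h1
    calc (3 : ℝ) * n = 12 * (n / 4) := by ring
      _ ≤ n * (p n : ℝ) * ε ^ 2 * (n / 4) := mul_le_mul_of_nonneg_right h1 (by positivity)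
      _ = (p n : ℝ) * (ε * n / 2 * (ε * n / 2)) := by ring
      _ ≤ _ := mul_le_mul_of_nonneg_left hsq (p n).2.1
  calc _ ≤ Real.exp (2 * n) * Real.exp (-((p n : ℝ) * ((⌊ε * n⌋₊ * ⌊ε * n⌋₊ : ℕ) : ℝ))) :=
        mul_le_mul h4 h5 (pow_nonneg one_sub_coe_nonneg _) (Real.exp_pos _).le
    _ ≤ _ := by
      rw [← Real.exp_add]
      exact Real.exp_le_exp.2 (by linarith)

/-- Blocks of length `l = ⌈D / p⌉` have `D ≤ p l ≤ D + 1`: some block lacks a neighbour of `v` with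
probability at most `k exp (-D)`, and the triangle term is `p (k p l) ^ 2`. The lower bound on `n p`
makes the `k` blocks fit into `A`. -/
lemma noStar_le_of_sparse {n : ℕ} {p : unitInterval} {ε D : ℝ} {k : ℕ} (hε : 0 < ε) (hk : 0 < k)
    (hD : 0 < D) (hDε : k * Real.exp (-D) ≤ ε / 2) (hpn : k * (D + 1) / ε ≤ n * (p : ℝ))
    (hp : (p : ℝ) * (k * (D + 1)) ^ 2 ≤ ε / 2) {A : Finset (Fin n)} (hA : A.card = ⌊ε * n⌋₊)
    {v : Fin n} (hv : v ∉ A) : (binomialRandom (Fin n) p).real (noStar A k v) ≤ ε := by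
  have hk' : (0 : ℝ) < k := Nat.cast_pos.2 hk
  have hp0 : 0 < (p : ℝ) := by
    refine p.2.1.lt_of_ne fun h => ?_
    rw [← h, mul_zero] at hpn
    exact absurd hpn (not_le.2 (by positivity))
  have hl1 : D ≤ (p : ℝ) * ⌈D / p⌉₊ := by
    rw [← div_le_iff₀' hp0]
    exact Nat.le_ceil _
  have hl2 : (p : ℝ) * ⌈D / p⌉₊ ≤ D + 1 := by
    have := (Nat.ceil_lt_add_one (div_nonneg hD.le hp0.le)).le
    calc (p : ℝ) * ⌈D / p⌉₊ ≤ p * (D / p + 1) := mul_le_mul_of_nonneg_left this hp0.le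
      _ = D + p := by field_simp
      _ ≤ D + 1 := by linarith [p.2.2]
  have hcard : k * ⌈D / p⌉₊ ≤ A.card := by
    rw [hA]
    refine Nat.le_floor ?_
    push_cast
    rw [div_le_iff₀ hε] at hpn
    refine le_of_mul_le_mul_left ?_ hp0
    calc (p : ℝ) * (k * ⌈D / p⌉₊) = k * (p * ⌈D / p⌉₊) := by ring
      _ ≤ k * (D + 1) := mul_le_mul_of_nonneg_left hl2 hk'.le
      _ ≤ _ := hpn.trans_eq (by ring)
  refine (binomialRandom_real_noStar_le_sparse hv hcard).trans ?_
  have h1 : k * (1 - p : ℝ) ^ ⌈D / p⌉₊ ≤ ε / 2 := by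
    refine le_trans (mul_le_mul_of_nonneg_left ?_ hk'.le) hDε
    exact (one_sub_pow_le_exp p.2.2 _).trans (Real.exp_le_exp.2 (by linarith))
  have h2 : (k * ⌈D / p⌉₊ : ℝ) ^ 2 * (p : ℝ) ^ 3 ≤ ε / 2 := by
    calc (k * ⌈D / p⌉₊ : ℝ) ^ 2 * (p : ℝ) ^ 3 = p * (k * (p * ⌈D / p⌉₊)) ^ 2 := by ring
      _ ≤ (p : ℝ) * ((k : ℝ) * (D + 1)) ^ 2 := by gcongr
      _ ≤ _ := hp
  linarith

lemma eventually_noStar_le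
    (hp : (fun _ : ℕ => (1 : ℝ)) =o[atTop] fun n : ℕ => (n : ℝ) * (p n : ℝ))
    (hp' : ∀ ε : ℝ, 0 < ε → ε < 1 →
      (fun n : ℕ => (n : ℝ) ^ ε) =o[atTop] fun n : ℕ => (n : ℝ) * (1 - (p n : ℝ)))
    {ε : ℝ} (hε : 0 < ε) {k : ℕ} (hk : 0 < k) :
    ∀ᶠ n : ℕ in atTop, ∀ A : Finset (Fin n), A.card = ⌊ε * n⌋₊ → ∀ v ∉ A,
      (binomialRandom (Fin n) (p n)).real (noStar A k v) ≤ ε := by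
  have hk' : (0 : ℝ) < k := Nat.cast_pos.2 hk
  have hk1 : (1 : ℝ) ≤ k := Nat.one_le_cast.2 hk
  obtain ⟨D, hD, hDε⟩ : ∃ D : ℝ, 0 < D ∧ k * Real.exp (-D) ≤ ε / 2 := by
    have : Tendsto (fun D : ℝ => k * Real.exp (-D)) atTop (𝓝 (k * 0)) :=
      Real.tendsto_exp_neg_atTop_nhds_zero.const_mul _
    rw [mul_zero] at this
    exact ((eventually_gt_atTop 0).and (this.eventually_le_const (half_pos hε))).exists
  -- The constant threshold below which the triangle term is at most `ε / 2`. The side on which `p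
  -- n` falls may vary with `n`.
  set p₀ : ℝ := ε / 2 / (k * (D + 1)) ^ 2 with hp₀
  have hp₀pos : 0 < p₀ := by positivity
  set c : ℝ := p₀ ^ k * (ε / (2 * k)) with hc
  have hcpos : 0 < c := by positivity
  have hexp : Tendsto (fun n : ℕ => Real.exp (-(c * (n : ℝ) ^ (1 / 2 : ℝ)))) atTop (𝓝 0) :=
    Real.tendsto_exp_neg_atTop_nhds_zero.comp
      (((tendsto_rpow_atTop (by norm_num)).comp tendsto_natCast_atTop_atTop).const_mul_atTop hcpos)
  have hkk : (0 : ℝ) < 1 / (2 * k ^ 2) ∧ 1 / (2 * k ^ 2 : ℝ) < 1 := by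
    refine ⟨by positivity, ?_⟩
    rw [div_lt_one (by positivity)]
    nlinarith
  -- The exponent `1 - 1 / (2 k ^ 2)` gives `1 - p ≥ n ^ (-1 / (2 k ^ 2))`, hence `(1 - p) ^ (k * k)
  -- ≥ n ^ (-1/2)`. With order `n` trials, the expected number of stars is at least `c n ^ (1/2)`.
  filter_upwards [eventually_le_mul_prob hp (k * (D + 1) / ε), hexp.eventually_le_const hε,
    (hp' (1 - 1 / (2 * k ^ 2)) (by linarith) (by linarith)).bound one_pos,
    tendsto_natCast_atTop_atTop.eventually_ge_atTop (2 * (k + 1) / ε),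
    eventually_gt_atTop 0] with n h1 h2 h3 h4 hn A hA v hv
  have hn' : (0 : ℝ) < n := Nat.cast_pos.2 hn
  rcases le_total (p n : ℝ) p₀ with hle | hle
  · refine noStar_le_of_sparse hε hk hD hDε h1 ?_ hA hv
    rwa [hp₀, le_div_iff₀ (by positivity)] at hle
  · refine (binomialRandom_real_noStar_le_dense (L := ⌊ε * n⌋₊ / k) hv
      (hA ▸ Nat.div_mul_le_self _ _)).trans (le_trans ?_ h2)
    -- The factor `2` absorbs both roundings, since `ε n ≥ 2 (k + 1)`.
    have hL : ε / (2 * k) * n ≤ ((⌊ε * n⌋₊ / k : ℕ) : ℝ) := by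
      have e1 := Nat.lt_floor_add_one (ε * n)
      have e2 : (⌊ε * n⌋₊ : ℝ) < k * ((⌊ε * n⌋₊ / k : ℕ) + 1) := by
        exact_mod_cast Nat.lt_mul_div_succ _ hk
      rw [div_le_iff₀ hε] at h4
      rw [div_mul_eq_mul_div, div_le_iff₀ (by positivity)]
      nlinarith
    have hq : (n : ℝ) ^ (-(1 / 2) : ℝ) ≤ (1 - (p n : ℝ)) ^ (k * k) := by
      rw [one_mul, Real.norm_of_nonneg (by positivity),
        Real.norm_of_nonneg (mul_nonneg hn'.le one_sub_coe_nonneg), sub_eq_add_neg,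
        Real.rpow_add hn', Real.rpow_one] at h3
      have h5 := le_of_mul_le_mul_left h3 hn'
      calc (n : ℝ) ^ (-(1 / 2) : ℝ) = ((n : ℝ) ^ (-(1 / (2 * k ^ 2)) : ℝ)) ^ (k * k) := by
            rw [← Real.rpow_natCast, ← Real.rpow_mul hn'.le]
            congr 1
            push_cast
            field_simp
        _ ≤ _ := pow_le_pow_left₀ (by positivity) h5 _
    have hle1 : (p n : ℝ) ^ k * (1 - p n : ℝ) ^ (k * k) ≤ 1 :=
      mul_le_one₀ (pow_le_one₀ (p n).2.1 (p n).2.2) (pow_nonneg one_sub_coe_nonneg _)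
        (pow_le_one₀ one_sub_coe_nonneg one_sub_coe_le_one)
    refine (one_sub_pow_le_exp hle1 _).trans (Real.exp_le_exp.2 (neg_le_neg ?_))
    calc c * (n : ℝ) ^ (1 / 2 : ℝ) = p₀ ^ k * (n : ℝ) ^ (-(1 / 2) : ℝ) * (ε / (2 * k) * n) := by
          have : (n : ℝ) ^ (1 / 2 : ℝ) = (n : ℝ) ^ (-(1 / 2) : ℝ) * n := by
            nth_rewrite 3 [← Real.rpow_one (n : ℝ)]
            rw [← Real.rpow_add hn']
            norm_num
          rw [this, hc]
          ring
      _ ≤ _ := by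
        have hpk : 0 ≤ (p n : ℝ) ^ k := pow_nonneg (p n).2.1 k
        exact mul_le_mul (mul_le_mul (pow_le_pow_left₀ hp₀pos.le hle k) hq (by positivity) hpk) hL
          (by positivity) (mul_nonneg hpk (pow_nonneg one_sub_coe_nonneg _))

variable {n : ℕ} {q : ℝ}

/-- A graph that expands and in which most vertices outside `A` are centres of induced stars has a
decision order of high quality. -/
lemma optimalQuality_ge (hq : 1 / 2 < q) (h1 : q < 1) (τ : TieRule n) {G : SimpleGraph (Fin n)}
    {m k t : ℕ} (hG : Expands G m) {A : Finset (Fin n)} (hA : A.card + 3 * m ≤ n)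
    (ht : t + m + A.card ≤ n) [DecidablePred fun v => G ∈ noStar A k v]
    (hstar : (Aᶜ.filter fun v => G ∈ noStar A k v).card < t) :
    (n - A.card - m) / (n : ℝ) * (1 - majorityRate q ^ k) ≤ optimalQuality q τ G := by
  classical
  have hAc : Aᶜ.card + A.card = n := by
    have := (add_comm _ _).trans (Finset.card_add_card_compl A)
    rwa [Fintype.card_fin] at this
  have hsplit := Finset.card_filter_add_card_filter_not (s := Aᶜ) fun v => G ∈ noStar A k v
  -- More than `m` vertices outside `A` are star centres, too many for all of them to avoid the
  -- large component.
  obtain ⟨v, hvW, hv⟩ := hG.exists_large_component A hA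
    (W := Aᶜ.filter fun v => ¬ G ∈ noStar A k v)
    (Finset.disjoint_left.2 fun w hw => Finset.mem_compl.1 (Finset.mem_filter.1 hw).1) (by omega)
  obtain ⟨hvA, hvS⟩ := Finset.mem_filter.1 hvW
  obtain ⟨S, hS⟩ := not_not.1 hvS
  obtain ⟨σ, hσ⟩ := exists_networkQuality_ge hq h1 τ G (Finset.mem_compl.1 hvA) hS
  refine le_trans (le_trans ?_ hσ) (networkQuality_le_optimalQuality τ G σ)
  have hρ : majorityRate q ^ k ≤ 1 :=
    pow_le_one₀ (majorityRate_nonneg hq h1) (majorityRate_lt_one hq).le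
  refine mul_le_mul_of_nonneg_right (div_le_div_of_nonneg_right ?_ n.cast_nonneg)
    (sub_nonneg.2 hρ)
  have : (n : ℝ) ≤ (Finset.univ.filter fun w => (isolate G A).Reachable v w).card + A.card + m :=
    mod_cast hv
  linarith

lemma erdosRenyiQuality_le_one (h0 : 0 ≤ q) (h1 : q ≤ 1) (τ : TieRule n) (p : unitInterval) :
    erdosRenyiQuality q n τ p ≤ 1 := by
  classical
  calc erdosRenyiQuality q n τ p ≤ ∑ G : SimpleGraph (Fin n),
        (binomialRandom (Fin n) p).real {G} :=
      Finset.sum_le_sum fun G _ =>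
        mul_le_of_le_one_right measureReal_nonneg (optimalQuality_le_one h0 h1 τ G)
    _ = 1 := by
      rw [sum_measureReal_singleton]
      simp

lemma mul_le_erdosRenyiQuality (h0 : 0 ≤ q) (h1 : q ≤ 1) (τ : TieRule n) (p : unitInterval)
    (E : Set (SimpleGraph (Fin n))) {c : ℝ} (hE : ∀ G ∈ E, c ≤ optimalQuality q τ G) :
    (binomialRandom (Fin n) p).real E * c ≤ erdosRenyiQuality q n τ p := by
  classical
  calc (binomialRandom (Fin n) p).real E * c
      = ∑ G ∈ Finset.univ.filter (· ∈ E), (binomialRandom (Fin n) p).real {G} * c := by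
        rw [← Finset.sum_mul, sum_measureReal_singleton]
        simp
    _ ≤ ∑ G ∈ Finset.univ.filter (· ∈ E),
          (binomialRandom (Fin n) p).real {G} * optimalQuality q τ G :=
        Finset.sum_le_sum fun G hG => mul_le_mul_of_nonneg_left
          (hE G (Finset.mem_filter.1 hG).2) measureReal_nonneg
    _ ≤ _ := Finset.sum_le_univ_sum_of_nonneg fun G =>
        mul_nonneg measureReal_nonneg (optimalQuality_nonneg h0 h1 τ G)

lemma eventually_le_erdosRenyiQuality (hq : 1 / 2 < q) (h1 : q < 1) (τ : ∀ n : ℕ, TieRule n)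
    (hp : (fun _ : ℕ => (1 : ℝ)) =o[atTop] fun n : ℕ => (n : ℝ) * (p n : ℝ))
    (hp' : ∀ ε : ℝ, 0 < ε → ε < 1 →
      (fun n : ℕ => (n : ℝ) ^ ε) =o[atTop] fun n : ℕ => (n : ℝ) * (1 - (p n : ℝ)))
    {ε : ℝ} (hε : 0 < ε) (hε' : ε ≤ 1 / 8) :
    ∀ᶠ n : ℕ in atTop, 1 - 7 * ε ≤ erdosRenyiQuality q n (τ n) (p n) := by
  classical
  have hq0 : 0 ≤ q := by linarith
  obtain ⟨k, hkpos, hk⟩ : ∃ k : ℕ, 0 < k ∧ majorityRate q ^ k ≤ ε :=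
    ((eventually_gt_atTop 0).and ((tendsto_pow_atTop_nhds_zero_of_lt_one
      (majorityRate_nonneg hq h1) (majorityRate_lt_one hq)).eventually_le_const hε)).exists
  filter_upwards [eventually_not_expands_le hp hε, eventually_noStar_le hp hp' hε hkpos,
    eventually_ge_atTop 3] with n hexp hstar hn
  have hn' : (3 : ℝ) ≤ n := by exact_mod_cast hn
  set m := ⌊ε * n⌋₊ with hm
  have hmle : (m : ℝ) ≤ ε * n := Nat.floor_le (by positivity)
  have hm8 : 8 * m ≤ n := by
    have : (8 * m : ℝ) ≤ n := by nlinarith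
    exact_mod_cast this
  -- `A` is chosen independently of the graph, so the bounds for a fixed set apply.
  obtain ⟨A, -, hA⟩ := Finset.exists_subset_card_eq (s := (Finset.univ : Finset (Fin n)))
    (n := m) (by simp; omega)
  set t := n / 2 with ht
  have htn : (n : ℝ) / 3 ≤ t := by
    have : n ≤ 3 * t := by omega
    have : (n : ℝ) ≤ 3 * t := by exact_mod_cast this
    linarith
  let μ := binomialRandom (Fin n) (p n)
  let E1 : Set (SimpleGraph (Fin n)) := {G | ¬ Expands G m}
  let E2 : Set (SimpleGraph (Fin n)) := {G | t ≤ (Aᶜ.filter fun v => G ∈ noStar A k v).card}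
  -- Markov: the expected number of vertices outside `A` without a star is at most `ε n`, against `t
  -- ≥ n / 3`.
  have hE2 : μ.real E2 ≤ 3 * ε := by
    have h := mul_measureReal_card_filter_ge_le μ Aᶜ (fun v => noStar A k v) t
    have hsum : ∑ v ∈ Aᶜ, μ.real (noStar A k v) ≤ n * ε := by
      calc _ ≤ ∑ v ∈ Aᶜ, ε := Finset.sum_le_sum fun v hv => hstar A hA v (Finset.mem_compl.1 hv)
        _ = (Aᶜ.card : ℝ) * ε := by rw [Finset.sum_const, nsmul_eq_mul]
        _ ≤ _ := by
          have : Aᶜ.card ≤ n := (Finset.card_le_univ _).trans_eq (Fintype.card_fin n)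
          gcongr
    have h3 : (n : ℝ) / 3 * μ.real E2 ≤ n * ε :=
      (mul_le_mul_of_nonneg_right htn measureReal_nonneg).trans (h.trans hsum)
    nlinarith
  have hgood : 1 - 4 * ε ≤ μ.real (E1 ∪ E2)ᶜ := by
    rw [probReal_compl_eq_one_sub MeasurableSet.of_discrete]
    have := measureReal_union_le (μ := μ) E1 E2
    have : μ.real E1 ≤ ε := hexp
    linarith
  have hqual : ∀ G ∈ (E1 ∪ E2)ᶜ, 1 - 3 * ε ≤ optimalQuality q (τ n) G := by
    intro G hG
    simp only [E1, E2, Set.mem_compl_iff, Set.mem_union, Set.mem_ofPred_eq, not_or, not_not,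
      not_le] at hG
    refine le_trans ?_ (optimalQuality_ge hq h1 (τ n) hG.1 (A := A) (by omega) (by omega) hG.2)
    have h2 : 1 - 2 * ε ≤ (n - A.card - m) / (n : ℝ) := by
      rw [le_div_iff₀ (by linarith), hA]
      nlinarith
    calc 1 - 3 * ε ≤ (1 - 2 * ε) * (1 - ε) := by nlinarith
      _ ≤ _ := mul_le_mul h2 (by linarith) (by linarith) (by linarith)
  refine le_trans ?_ (mul_le_erdosRenyiQuality hq0 h1.le (τ n) (p n) _ hqual)
  -- The loss `4 ε` is the probability of a bad graph (`ε + 3 ε`); `3 ε` covers the vertices missed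
  -- (`2 ε`) and the error of the vote (`ε`).
  calc 1 - 7 * ε ≤ (1 - 4 * ε) * (1 - 3 * ε) := by nlinarith
    _ ≤ _ := mul_le_mul_of_nonneg_right hgood (by linarith)

end Asymptotic

end SocialLearning

theorem mainTheorem8 (q : ℝ) (hq : q ∈ Set.Ioo (1 / 2 : ℝ) 1)
    (τ : ∀ n : ℕ, SocialLearning.TieRule n)
    (p : ℕ → unitInterval)
    (hp : (fun _ : ℕ => (1 : ℝ)) =o[atTop] fun n : ℕ => (n : ℝ) * (p n : ℝ))
    (hp' : ∀ ε : ℝ, 0 < ε → ε < 1 →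
      (fun n : ℕ => (n : ℝ) ^ ε) =o[atTop] fun n : ℕ => (n : ℝ) * (1 - (p n : ℝ))) :
    SocialLearning.ErdosRenyiTruthLearning q τ p := by
  refine tendsto_order.2 ⟨fun a ha => ?_, fun a ha => Eventually.of_forall fun n =>
    (SocialLearning.erdosRenyiQuality_le_one (by linarith [hq.1]) hq.2.le (τ n) (p n)).trans_lt ha⟩
  -- Dividing by `8` makes `7 ε` strictly smaller than `1 - a`.
  have hε : 0 < min (1 / 8) ((1 - a) / 8) := lt_min (by norm_num) (by linarith)
  filter_upwards [SocialLearning.eventually_le_erdosRenyiQuality hq.1 hq.2 τ hp hp' hε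
    (min_le_left _ _)] with n hn
  have := min_le_right (1 / 8) ((1 - a) / 8)
  linarith
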